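/- Let $(X,\mathcal A,\mu)$ and $(Y,\mathcal B,\nu)$ be probability spaces with separable $\sigma$-algebras modulo null sets, so that $L^2(X)$ and $L^2(Y)$ are separable (for example, Lebesgue spaces). For an invertible measure-preserving transformation $T$ of $X$ let $U_Tf=f\circ T^{-1}$ be its unitary operator on $L^2(X)$ and let $L^2_0(X)=\{f\in L^2(X):\int f\,d\mu=0\}$. For $f\in L^2_0(X)$ let $\sigma_f$ be the finite Borel measure on the unit circle with $\int z^n\,d\sigma_f=\langle U_T^nf,f\rangle$ for all $n\in\mathbb Z$. The reduced maximal spectral type $\sigma_T^{(0)}$ is the class, up to mutual absolute continuity, of the finite Borel measures $\sigma$ on the circle such that $\sigma_f\ll\sigma$ for all $f\in L^2_0(X)$ and $\sigma\ll\rho$ for every Borel measure $\rho$ with $\sigma_f\ll\rho$ for all $f\in L^2_0(X)$; similarly for transformations of $Y$. Let $T$ be a weakly mixing invertible measure-preserving transformation of $X$. Let $P$ be a function that is analytic in a neighbourhood of the unit circle and does not vanish identically on the circle, and let $(n_k)_{k\in\mathbb N}$ be a sequence of integers taking infinitely many different values. Suppose that $U_T^{n_k}$ converges weakly to $P(U_T)$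 on $L^2_0(X)$, that is, $\langle U_T^{n_k}f,g\rangle\to\langle P(U_T)f,g\rangle$ for all $f,g\in L^2_0(X)$, where $P(U_T)$ is given by the continuous functional calculus. Then $T$ is spectrally disjoint from every mixing invertible measure-preserving transformation $S$ of $Y$: the reduced maximal spectral types $\sigma_T^{(0)}$ and $\sigma_S^{(0)}$ exist and are mutually singular. -/

import Mathlib

open MeasureTheory Filter Topology

namespace SpectralDisjoint

/-- The Borel σ-algebra of the unit circle. -/
noncomputable instance instMeasurableSpaceCircle : MeasurableSpace Circle := borel Circle

instance instBorelSpaceCircle : BorelSpace Circle := ⟨rfl⟩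

section Koopman

variable {X : Type*} [MeasurableSpace X] {μ : Measure X}

/-- The Koopman operator `U_T f = f ∘ T⁻¹` of an invertible measure-preserving transformation,
as a unitary operator of `L²(X, μ)`. -/
noncomputable def koopman (T : X ≃ᵐ X) (hT : MeasurePreserving T μ μ) :
    Lp ℂ 2 μ ≃ₗᵢ[ℂ] Lp ℂ 2 μ :=
  LinearIsometryEquiv.ofSurjective
    (Lp.compMeasurePreservingₗᵢ ℂ (T.symm : X → X) (hT.symm T))
    (fun g => ⟨Lp.compMeasurePreserving T hT g, by
      have h := Lp.compMeasurePreserving_comp_apply g hT (hT.symm T)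
      have hid : ((T : X → X) ∘ (T.symm : X → X)) = id := by
        funext x; simp
      change Lp.compMeasurePreserving (T.symm : X → X) (hT.symm T)
        (Lp.compMeasurePreserving T hT g) = g
      rw [← h]
      simp only [hid]
      exact Lp.compMeasurePreserving_id_apply g⟩)

/-- The functions of `L²(X, μ)` with zero integral. -/
def L2zero (μ : Measure X) : Set (Lp ℂ 2 μ) := {f | ∫ x, f x ∂μ = 0}

/-- `T` is weakly mixing: `(1/N) ∑_{n<N} |μ(T⁻ⁿA ∩ B) - μ(A) μ(B)| → 0` for all measurable
`A`, `B`. -/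
def WeaklyMixing (T : X → X) (μ : Measure X) : Prop :=
  ∀ A B : Set X, MeasurableSet A → MeasurableSet B →
    Tendsto
      (fun N : ℕ => (∑ n ∈ Finset.range N,
        |μ.real ((T^[n]) ⁻¹' A ∩ B) - μ.real A * μ.real B|) / (N : ℝ))
      atTop (𝓝 0)

/-- `T` is (strongly) mixing: `μ(T⁻ⁿA ∩ B) → μ(A) μ(B)` for all measurable `A`, `B`. -/
def Mixing (T : X → X) (μ : Measure X) : Prop :=
  ∀ A B : Set X, MeasurableSet A → MeasurableSet B →
    Tendsto (fun n : ℕ => μ.real ((T^[n]) ⁻¹' A ∩ B)) atTop (𝓝 (μ.real A * μ.real B))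

end Koopman

section Spectral

variable {H : Type*} [NormedAddCommGroup H] [InnerProductSpace ℂ H]

/-- `σ` is the spectral measure `σ_f` of the vector `f` under the unitary operator `U`: the finite
Borel measure on the circle with `∫ zⁿ dσ = ⟨Uⁿ f, f⟩` for all `n ∈ ℤ` (Mathlib's inner product is
linear in its second argument). -/
structure IsSpectralMeasure (U : H ≃ₗᵢ[ℂ] H) (f : H) (σ : Measure Circle) : Prop where
  finite : IsFiniteMeasure σ
  fourier : ∀ n : ℤ, ∫ z : Circle, ((z ^ n : Circle) : ℂ) ∂σ = inner ℂ f ((U ^ n) f)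

/-- `σ` is a finite measure in the maximal spectral type of `U` over the vectors in `K`: it
dominates all spectral measures of vectors in `K`, and it is absolutely continuous with respect to
every measure that does. -/
structure IsMaximalSpectralType (U : H ≃ₗᵢ[ℂ] H) (K : Set H) (σ : Measure Circle) : Prop where
  finite : IsFiniteMeasure σ
  dominates : ∀ f ∈ K, ∀ ρ : Measure Circle, IsSpectralMeasure U f ρ → ρ ≪ σ
  minimal : ∀ ν : Measure Circle,
    (∀ f ∈ K, ∀ ρ : Measure Circle, IsSpectralMeasure U f ρ → ρ ≪ ν) → σ ≪ ν

end Spectral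

/-- Spectral disjointness: the reduced maximal spectral types (those of the Koopman operators on
functions with zero integral) are mutually singular. A maximal spectral type is determined up to
equivalence of measures, so the choice of representatives does not matter; that there are
representatives is part of the assertion. -/
def SpectrallyDisjoint {X Y : Type*} [MeasurableSpace X] [MeasurableSpace Y]
    {μ : Measure X} {ν : Measure Y} (T : X ≃ᵐ X) (hT : MeasurePreserving T μ μ)
    (S : Y ≃ᵐ Y) (hS : MeasurePreserving S ν ν) : Prop :=
  ∃ σ τ : Measure Circle,
    IsMaximalSpectralType (koopman T hT) (L2zero μ) σ ∧
    IsMaximalSpectralType (koopman S hS) (L2zero ν) τ ∧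
    σ ⟂ₘ τ

/-- `P(U_T)` for a function `P` that is continuous on the unit circle, by the continuous functional
calculus of the unitary operator `U_T`. For `P(z) = ∑ aⱼ zʲ` with `∑ |aⱼ| < ∞` it is
`∑ aⱼ U_Tʲ`. -/
noncomputable def koopmanFun {X : Type*} [MeasurableSpace X] {μ : Measure X} (P : ℂ → ℂ)
    (T : X ≃ᵐ X) (hT : MeasurePreserving T μ μ) : Lp ℂ 2 μ →L[ℂ] Lp ℂ 2 μ :=
  cfc P ((koopman T hT).toContinuousLinearEquiv : Lp ℂ 2 μ →L[ℂ] Lp ℂ 2 μ)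

end SpectralDisjoint

/-! In spectral terms, weak convergence of `U_T ^ n_k` to `P(U_T)` says that `z ^ n_k → P` weak-* in
`L^∞(σ)` for each spectral measure `σ` of `T`. Mixing of `S` says that each spectral measure `τ` of
`S` is Rajchman: `z ^ n → 0` weak-* in `L^∞(τ)`. Both properties pass to absolutely continuous
measures, because the test functions range over all of `L¹` (`tendsto_integral_mul_of_circleChar`).
On the part `κ` of `σ` that is absolutely continuous with respect to `τ` the two limits must agree,
so `P = 0` almost everywhere for `κ`. Analyticity leaves `P` countably many zeros on the circle, and
a Rajchman measure has no atoms, hence `κ = 0` (`mutuallySingular_of_rajchman`).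

Maximal spectral types are represented by countable weighted sums of spectral measures
(`exists_isMaximalSpectralType`), so singularity need only be checked for pairs of vectors. -/

namespace SpectralDisjoint

/-! ### Trigonometric polynomials and finite measures on the circle -/

/-- The character `z ↦ zⁿ` of the circle, as a continuous function. -/
noncomputable def circleChar (n : ℤ) : C(Circle, ℂ) :=
  ⟨fun z => ((z ^ n : Circle) : ℂ), continuous_subtype_val.comp (continuous_zpow n)⟩

@[simp]
theorem circleChar_apply (n : ℤ) (z : Circle) : circleChar n z = ((z ^ n : Circle) : ℂ) := rfl

theorem circleChar_zero : circleChar 0 = 1 := by ext z; simp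

theorem circleChar_add (m n : ℤ) : circleChar (m + n) = circleChar m * circleChar n := by
  ext z
  simp only [circleChar_apply, ContinuousMap.mul_apply, zpow_add, Circle.coe_mul]

theorem star_circleChar (n : ℤ) : star (circleChar n) = circleChar (-n) := by
  ext z
  simp only [ContinuousMap.star_apply, circleChar_apply, zpow_neg, Circle.coe_inv_eq_conj]
  rfl

theorem norm_circleChar_apply (n : ℤ) (z : Circle) : ‖circleChar n z‖ = 1 :=
  Circle.norm_coe _

/-- The star subalgebra of `C(Circle, ℂ)` generated by the characters. -/
noncomputable def circleCharSubalgebra : StarSubalgebra ℂ C(Circle, ℂ) where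
  toSubalgebra := Algebra.adjoin ℂ (Set.range circleChar)
  star_mem' := by
    change Algebra.adjoin ℂ (Set.range circleChar) ≤
      star (Algebra.adjoin ℂ (Set.range circleChar))
    refine Algebra.adjoin_le ?_
    rintro - ⟨n, rfl⟩
    exact Algebra.subset_adjoin ⟨-n, (star_circleChar n).symm⟩

/-- The characters are closed under products and include 1, so generating an algebra adds nothing to
their linear span. -/
theorem circleCharSubalgebra_toSubmodule :
    Subalgebra.toSubmodule circleCharSubalgebra.toSubalgebra
      = Submodule.span ℂ (Set.range circleChar) := by
  apply Algebra.adjoin_eq_span_of_subset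
  refine Set.Subset.trans ?_ Submodule.subset_span
  intro x hx
  refine Submonoid.closure_induction (fun _ => id) ⟨0, circleChar_zero⟩ ?_ hx
  rintro - - - - ⟨m, rfl⟩ ⟨n, rfl⟩
  exact ⟨m + n, circleChar_add m n⟩

/-- Trigonometric polynomials are uniformly dense in `C(Circle, ℂ)`. -/
theorem span_circleChar_closure_eq_top :
    (Submodule.span ℂ (Set.range circleChar)).topologicalClosure = ⊤ := by
  rw [← circleCharSubalgebra_toSubmodule]
  have h : circleCharSubalgebra.topologicalClosure = ⊤ :=
    ContinuousMap.starSubalgebra_topologicalClosure_eq_top_of_separatesPoints _ (by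
      intro x y hxy
      refine ⟨_, ⟨circleChar 1, Algebra.subset_adjoin ⟨1, rfl⟩, rfl⟩, ?_⟩
      simpa [Circle.ext_iff] using hxy)
  exact congr_arg (fun A => Subalgebra.toSubmodule (StarSubalgebra.toSubalgebra A)) h

/-- A closed subspace of `C(Circle, ℂ)` that contains the characters is everything. -/
theorem mem_of_circleChar_mem (M : Submodule ℂ C(Circle, ℂ)) (hM : IsClosed (M : Set C(Circle, ℂ)))
    (h : ∀ n, circleChar n ∈ M) (f : C(Circle, ℂ)) : f ∈ M := by
  have h1 : (Submodule.span ℂ (Set.range circleChar)).topologicalClosure ≤ M :=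
    Submodule.topologicalClosure_minimal _ (Submodule.span_le.2 (by rintro - ⟨n, rfl⟩; exact h n)) hM
  rw [span_circleChar_closure_eq_top] at h1
  exact h1 trivial

theorem integrable_continuousMap (σ : Measure Circle) [IsFiniteMeasure σ] (f : C(Circle, ℂ)) :
    Integrable f σ :=
  (BoundedContinuousFunction.mkOfCompact f).integrable σ

/-- Integration against a finite measure is continuous on `C(Circle, ℂ)`. -/
theorem continuous_integral_continuousMap (σ : Measure Circle) [IsFiniteMeasure σ] :
    Continuous fun f : C(Circle, ℂ) => ∫ z, f z ∂σ := by
  refine continuous_iff_continuousAt.2 fun f => ?_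
  refine tendsto_integral_filter_of_norm_le_const 
    (Eventually.of_forall fun g : C(Circle, ℂ) => g.continuous.aestronglyMeasurable) ⟨‖f‖ + 1, ?_⟩ ?_
  · have : ∀ᶠ g : C(Circle, ℂ) in 𝓝 f, ‖g‖ < ‖f‖ + 1 :=
      continuous_norm.continuousAt.eventually_lt_const (by simp)
    filter_upwards [this] with g hg
    exact Eventually.of_forall fun z => (g.norm_coe_le_norm z).trans hg.le
  · exact Eventually.of_forall fun z => (continuous_eval_const z).tendsto f

/-- Finite measures on the circle are determined by their Fourier coefficients. -/
theorem measure_ext_of_fourier {σ τ : Measure Circle} [IsFiniteMeasure σ] [IsFiniteMeasure τ]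
    (h : ∀ n, ∫ z, circleChar n z ∂σ = ∫ z, circleChar n z ∂τ) : σ = τ := by
  let M : Submodule ℂ C(Circle, ℂ) :=
    { carrier := {f | ∫ z, f z ∂σ = ∫ z, f z ∂τ}
      add_mem' := by
        intro f g hf hg
        simp only [Set.mem_ofPred_eq, ContinuousMap.add_apply] at *
        rw [integral_add (integrable_continuousMap σ f) (integrable_continuousMap σ g),
          integral_add (integrable_continuousMap τ f) (integrable_continuousMap τ g), hf, hg]
      zero_mem' := by simp
      smul_mem' := by
        intro c f hf
        simp only [Set.mem_ofPred_eq, ContinuousMap.smul_apply] at *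
        rw [integral_smul, integral_smul, hf] }
  have hM := mem_of_circleChar_mem M
    (isClosed_eq (continuous_integral_continuousMap σ) (continuous_integral_continuousMap τ)) h
  refine ext_of_forall_integral_eq_of_IsFiniteMeasure fun f => ?_
  have := hM ⟨fun z => (f z : ℂ), Complex.continuous_ofReal.comp f.continuous⟩
  change ∫ z, (f z : ℂ) ∂σ = ∫ z, (f z : ℂ) ∂τ at this
  rw [integral_complex_ofReal, integral_complex_ofReal] at this
  exact_mod_cast this

/-! ### Weak convergence tested on characters -/

/-- For a uniformly bounded family of additive maps, the set of points where it tends to zero is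
closed. -/
theorem isClosed_setOf_tendsto_zero {ι E F : Type*} [SeminormedAddCommGroup E]
    [SeminormedAddCommGroup F] (l : Filter ι) (L : ι → E →+ F) (C : ℝ)
    (hL : ∀ i x, ‖L i x‖ ≤ C * ‖x‖) : IsClosed {x | Tendsto (fun i => L i x) l (𝓝 0)} := by
  refine isClosed_of_closure_subset fun x hx => ?_
  refine Metric.tendsto_nhds.2 fun ε hε => ?_
  -- The constant `|C| + 1` is a divisor that stays positive whatever the sign of `C`.
  have hC : 0 < |C| + 1 := by positivity
  obtain ⟨y, hy, hxy⟩ := Metric.mem_closure_iff.1 hx (ε / 2 / (|C| + 1)) (by positivity)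
  filter_upwards [Metric.tendsto_nhds.1 hy (ε / 2) (by positivity)] with i hi
  rw [dist_zero_right] at hi ⊢
  have h1 : ‖L i (x - y)‖ ≤ (|C| + 1) * ‖x - y‖ := (hL i _).trans (by
    gcongr; linarith [le_abs_self C])
  have h2 : (|C| + 1) * ‖x - y‖ < ε / 2 := by
    rw [dist_eq_norm, lt_div_iff₀ hC] at hxy
    linarith
  calc ‖L i x‖ = ‖L i (x - y) + L i y‖ := by rw [← map_add, sub_add_cancel]
    _ ≤ ‖L i (x - y)‖ + ‖L i y‖ := norm_add_le _ _
    _ < ε := by linarith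

/-- If bounded continuous functions `ψᵢ` tend to zero against all characters with respect to `σ`,
then they do so against every integrable function. -/
theorem tendsto_integral_mul_of_circleChar {ι : Type*} {l : Filter ι} (σ : Measure Circle)
    [IsFiniteMeasure σ] (ψ : ι → C(Circle, ℂ)) (C : ℝ) (hC : ∀ i z, ‖ψ i z‖ ≤ C)
    (h : ∀ m, Tendsto (fun i => ∫ z, ψ i z * circleChar m z ∂σ) l (𝓝 0))
    {f : Circle → ℂ} (hf : Integrable f σ) :
    Tendsto (fun i => ∫ z, ψ i z * f z ∂σ) l (𝓝 0) := by
  have hint : ∀ i {g : Circle → ℂ}, Integrable g σ → Integrable (fun z => ψ i z * g z) σ :=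
    fun i g hg => hg.bdd_mul (ψ i).continuous.aestronglyMeasurable
      (Eventually.of_forall (hC i))
  let L : ι → Lp ℂ 1 σ →ₗ[ℂ] ℂ := fun i =>
    { toFun := fun g => ∫ z, ψ i z * g z ∂σ
      map_add' := fun g k => by
        rw [← integral_add (hint i (L1.integrable_coeFn g)) (hint i (L1.integrable_coeFn k))]
        refine integral_congr_ae ?_
        filter_upwards [Lp.coeFn_add g k] with z hz
        rw [hz, Pi.add_apply, mul_add]
      map_smul' := fun c g => by
        rw [RingHom.id_apply, ← integral_smul]
        refine integral_congr_ae ?_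
        filter_upwards [Lp.coeFn_smul c g] with z hz
        rw [hz, Pi.smul_apply, smul_eq_mul, smul_eq_mul]
        ring }
  have hL : ∀ i g, ‖L i g‖ ≤ C * ‖g‖ := by
    intro i g
    calc ‖L i g‖ ≤ ∫ z, ‖ψ i z * g z‖ ∂σ := norm_integral_le_integral_norm _
      _ ≤ ∫ z, C * ‖g z‖ ∂σ := by
        refine integral_mono (hint i (L1.integrable_coeFn g)).norm
          ((L1.integrable_coeFn g).norm.const_mul C) fun z => ?_
        simp only [norm_mul]
        exact mul_le_mul_of_nonneg_right (hC i z) (norm_nonneg _)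
      _ = C * ‖g‖ := by rw [integral_const_mul, L1.norm_eq_integral_norm]
  -- The good test functions form a closed subspace of `L¹`, by the uniform bound. It contains the
  -- characters, hence the continuous functions, hence everything.
  let M : Submodule ℂ (Lp ℂ 1 σ) :=
    { carrier := {g | Tendsto (fun i => L i g) l (𝓝 0)}
      add_mem' := by
        intro g k hg hk
        simpa using Tendsto.add hg hk
      zero_mem' := by simp [tendsto_const_nhds]
      smul_mem' := by
        intro c g hg
        simpa using Tendsto.const_mul c hg }
  have hMc : IsClosed (M : Set (Lp ℂ 1 σ)) :=
    isClosed_setOf_tendsto_zero l (fun i => (L i).toAddMonoidHom) C hL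
  have hcoe : ∀ (i) (g : C(Circle, ℂ)),
      L i (ContinuousMap.toLp 1 σ ℂ g) = ∫ z, ψ i z * g z ∂σ := by
    intro i g
    refine integral_congr_ae ?_
    filter_upwards [ContinuousMap.coeFn_toLp (p := 1) (𝕜 := ℂ) σ g] with z hz
    rw [hz]
  have h1 : ∀ g : C(Circle, ℂ), ContinuousMap.toLp 1 σ ℂ g ∈ M := by
    refine mem_of_circleChar_mem (M.comap (ContinuousMap.toLp 1 σ ℂ).toLinearMap)
      (hMc.preimage (ContinuousMap.toLp 1 σ ℂ).continuous) fun m => ?_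
    change Tendsto (fun i => L i (ContinuousMap.toLp 1 σ ℂ (circleChar m))) l (𝓝 0)
    simp only [hcoe]
    exact h m
  have h2 : hf.toL1 f ∈ M :=
    (ContinuousMap.toLp_denseRange ℂ σ ℂ ENNReal.one_ne_top).induction_on
      (p := fun g => g ∈ M) _ hMc h1
  refine Tendsto.congr (fun i => ?_) h2
  refine integral_congr_ae ?_
  filter_upwards [hf.coeFn_toL1] with z hz
  rw [hz]

/-! ### Rajchman measures and the singularity criterion -/

/-- A finite measure is Rajchman if its Fourier coefficients tend to zero. -/
def Rajchman (τ : Measure Circle) : Prop :=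
  Tendsto (fun n : ℤ => ∫ z, circleChar n z ∂τ) cofinite (𝓝 0)

theorem Rajchman.tendsto_integral_mul {τ : Measure Circle} [IsFiniteMeasure τ] (h : Rajchman τ)
    {f : Circle → ℂ} (hf : Integrable f τ) :
    Tendsto (fun n : ℤ => ∫ z, circleChar n z * f z ∂τ) cofinite (𝓝 0) := by
  refine tendsto_integral_mul_of_circleChar τ circleChar 1
    (fun i z => (norm_circleChar_apply i z).le) (fun m => ?_) hf
  have := h.comp (add_left_injective m).tendsto_cofinite
  refine this.congr fun n => ?_
  simp only [Function.comp_apply, circleChar_add, ContinuousMap.mul_apply]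

theorem integral_mul_rnDeriv {σ κ : Measure Circle} [IsFiniteMeasure σ] [IsFiniteMeasure κ]
    (h : κ ≪ σ) (f g : Circle → ℂ) :
    ∫ z, f z * (((κ.rnDeriv σ z).toReal : ℂ) * g z) ∂σ = ∫ z, f z * g z ∂κ := by
  rw [← integral_rnDeriv_smul h]
  refine integral_congr_ae (Eventually.of_forall fun z => ?_)
  simp only [Complex.real_smul]
  ring

theorem integrable_rnDeriv_mul {σ κ : Measure Circle} [IsFiniteMeasure σ] [IsFiniteMeasure κ]
    (h : κ ≪ σ) {g : Circle → ℂ} (hg : Integrable g κ) :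
    Integrable (fun z => ((κ.rnDeriv σ z).toReal : ℂ) * g z) σ := by
  simpa only [Complex.real_smul] using (integrable_rnDeriv_smul_iff h).2 hg

/-- The density `dκ/dσ` is an admissible `L¹` test function for `σ`. -/
theorem Rajchman.of_absolutelyContinuous {σ κ : Measure Circle} [IsFiniteMeasure σ]
    [IsFiniteMeasure κ] (hσ : Rajchman σ) (h : κ ≪ σ) : Rajchman κ := by
  refine (hσ.tendsto_integral_mul (integrable_rnDeriv_mul h (integrable_const (1 : ℂ)))).congr
    fun n => ?_
  rw [integral_mul_rnDeriv h]
  simp only [mul_one]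

/-- Tested against the indicator of `{a}`, the characters give `aⁿ τ{a}`, whose modulus does not
depend on `n` and yet tends to zero. -/
theorem Rajchman.noAtoms {τ : Measure Circle} [IsFiniteMeasure τ] (h : Rajchman τ) :
    NullSingletonClass τ := by
  refine ⟨fun a => ?_⟩
  have h1 := h.tendsto_integral_mul
    ((integrable_const (1 : ℂ)).indicator (measurableSet_singleton a))
  have h2 : ∀ n : ℤ, ‖∫ z, circleChar n z * ({a} : Set Circle).indicator (fun _ => (1 : ℂ)) z ∂τ‖
      = τ.real {a} := by
    intro n
    have : (fun z => circleChar n z * ({a} : Set Circle).indicator (fun _ => (1 : ℂ)) z)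
        = ({a} : Set Circle).indicator fun _ => circleChar n a := by
      ext z
      by_cases hz : z = a <;> simp [hz]
    rw [this, integral_indicator_const _ (measurableSet_singleton a), norm_smul,
      norm_circleChar_apply]
    simp
  have h3 := h1.norm
  simp only [h2, norm_zero] at h3
  have h4 := tendsto_nhds_unique h3 tendsto_const_nhds
  simpa [Measure.real, ENNReal.toReal_eq_zero_iff] using h4.symm

/-- If the characters `z ^ nᵢ` converge weakly to `P` with respect to `σ` along a sequence of
exponents leaving all finite sets, and `P` has countably many zeros, then `σ` is singular to every
Rajchman measure. -/
theorem mutuallySingular_of_rajchman {ι : Type*} {l : Filter ι} [l.NeBot] {n : ι → ℤ}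
    (hn : Tendsto n l cofinite) {σ τ : Measure Circle} [IsFiniteMeasure σ] [IsFiniteMeasure τ]
    (P : C(Circle, ℂ)) (hP : {z | P z = 0}.Countable)
    (hσ : ∀ m, Tendsto (fun i => ∫ z, circleChar (n i + m) z ∂σ) l
      (𝓝 (∫ z, circleChar m z * P z ∂σ)))
    (hτ : Rajchman τ) : σ ⟂ₘ τ := by
  -- The absolutely continuous part of `σ` relative to `τ`; it inherits the limit `P` from `κ ≤ σ`
  -- and the limit 0 from `κ ≪ τ`. It remains to show that it vanishes.
  set κ := τ.withDensity (σ.rnDeriv τ) with hκ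
  have hκσ : κ ≤ σ := Measure.withDensity_rnDeriv_le σ τ
  have hκτ : κ ≪ τ := withDensity_absolutelyContinuous _ _
  have : IsFiniteMeasure κ := isFiniteMeasure_of_le σ hκσ
  have hR : Rajchman κ := hτ.of_absolutelyContinuous hκτ
  have hPs : Integrable (fun z => star (P z)) κ := integrable_continuousMap κ (star P)
  have h1 : Tendsto (fun i => ∫ z, circleChar (n i) z * star (P z) ∂κ) l (𝓝 0) :=
    (hR.tendsto_integral_mul hPs).comp hn
  have h2 : Tendsto (fun i => ∫ z, (circleChar (n i) - P) z *
      (((κ.rnDeriv σ z).toReal : ℂ) * star (P z)) ∂σ) l (𝓝 0) := by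
    refine tendsto_integral_mul_of_circleChar σ (fun i => circleChar (n i) - P) (1 + ‖P‖)
      (fun i z => ?_) (fun m => ?_) (integrable_rnDeriv_mul hκσ.absolutelyContinuous hPs)
    · rw [ContinuousMap.sub_apply]
      exact (norm_sub_le _ _).trans
        (add_le_add (norm_circleChar_apply _ _).le (P.norm_coe_le_norm z))
    · have h := (hσ m).sub_const (∫ z, circleChar m z * P z ∂σ)
      rw [sub_self] at h
      refine h.congr fun i => ?_
      refine (integral_sub (integrable_continuousMap σ _)
        (integrable_continuousMap σ (circleChar m * P))).symm.trans ?_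
      refine integral_congr_ae (Eventually.of_forall fun z => ?_)
      simp only [circleChar_add, ContinuousMap.mul_apply, ContinuousMap.sub_apply]
      ring
  simp only [integral_mul_rnDeriv hκσ.absolutelyContinuous] at h2
  -- The difference of the integrands in `h1` and `h2` is `P * star P`, independent of `i`.
  have h3 : ∫ z, P z * star (P z) ∂κ = 0 := by
    have h4 := h1.sub h2
    rw [sub_zero] at h4
    refine tendsto_nhds_unique (Tendsto.congr (fun i => ?_) tendsto_const_nhds) h4
    refine Eq.trans ?_ (integral_sub (integrable_continuousMap κ (circleChar (n i) * star P))
      (integrable_continuousMap κ ((circleChar (n i) - P) * star P)))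
    refine integral_congr_ae (Eventually.of_forall fun z => ?_)
    simp only [ContinuousMap.sub_apply]
    ring
  have h4 : ∫ z, ‖P z‖ ^ 2 ∂κ = 0 := by
    have h5 : ∀ z, P z * star (P z) = ((‖P z‖ ^ 2 : ℝ) : ℂ) := by
      intro z
      rw [Complex.star_def, Complex.mul_conj']
      push_cast
      rfl
    simp only [h5] at h3
    rw [integral_complex_ofReal] at h3
    exact_mod_cast h3
  have h5 : (fun z => ‖P z‖ ^ 2) =ᵐ[κ] 0 := by
    refine (integral_eq_zero_iff_of_nonneg (fun z => by positivity) ?_).1 h4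
    exact (P.continuous.norm.pow 2).integrable_of_hasCompactSupport
      (HasCompactSupport.of_compactSpace _)
  have := hR.noAtoms
  have h6 : κ = 0 := by
    have h7 : ∀ᵐ z ∂κ, z ∉ {z | P z = 0} := measure_eq_zero_iff_ae_notMem.1 (hP.measure_zero κ)
    rw [← ae_eq_bot, ← eventually_false_iff_eq_bot]
    filter_upwards [h5, h7] with z hz hz'
    exact hz' (by simpa using hz)
  have h7 := Measure.haveLebesgueDecomposition_add σ τ
  rw [← hκ, h6, add_zero] at h7
  rw [h7]
  exact Measure.mutuallySingular_singularPart σ τ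

/-- An analytic function on a neighbourhood of the unit circle that does not vanish identically on
the circle has countably many zeros there. -/
theorem countable_zeros_of_analyticOnNhd_sphere {P : ℂ → ℂ}
    (hP : AnalyticOnNhd ℂ P (Metric.sphere 0 1))
    (hP0 : ∃ z ∈ Metric.sphere (0 : ℂ) 1, P z ≠ 0) : {z : Circle | P z = 0}.Countable := by
  have hpre : IsPreconnected (Metric.sphere (0 : ℂ) 1) :=
    isPreconnected_sphere (by rw [Complex.rank_real_complex]; norm_num) 0 1
  rcases hP.eqOn_zero_or_eventually_ne_zero_of_preconnected hpre with h | h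
  · obtain ⟨z, hz, hz0⟩ := hP0
    exact absurd (h hz) hz0
  -- The zero set is discrete in the compact circle, hence finite.
  · have h1 := (isCompact_sphere (0 : ℂ) 1).finite_sdiff_of_mem_codiscreteWithin h
    have h2 : ((fun z : Circle => (z : ℂ)) ⁻¹' (Metric.sphere (0 : ℂ) 1 \ {x | P x ≠ 0})).Countable :=
      h1.countable.preimage_of_injOn Circle.coe_injective.injOn
    refine h2.mono fun z hz => ?_
    simpa [Set.mem_preimage, Set.mem_sdiff] using ⟨Circle.norm_coe z, hz⟩

/-! ### Spectral measures of unitary operators -/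

section SpectralMeasure

variable {H : Type*} [NormedAddCommGroup H] [InnerProductSpace ℂ H] [CompleteSpace H]

/-- A unitary operator as a continuous linear map. -/
noncomputable abbrev unitaryCLM (U : H ≃ₗᵢ[ℂ] H) : H →L[ℂ] H :=
  (U.toContinuousLinearEquiv : H →L[ℂ] H)

theorem unitaryCLM_mem_unitary (U : H ≃ₗᵢ[ℂ] H) : unitaryCLM U ∈ unitary (H →L[ℂ] H) := by
  have hadj : star (unitaryCLM U) = (U.symm.toContinuousLinearEquiv : H →L[ℂ] H) :=
    ContinuousLinearMap.ext fun x => ext_inner_right ℂ fun y => by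
      rw [ContinuousLinearMap.star_eq_adjoint, ContinuousLinearMap.adjoint_inner_left]
      change inner ℂ x (U y) = inner ℂ (U.symm x) y
      rw [← U.inner_map_map (U.symm x), U.apply_symm_apply]
  rw [Unitary.mem_iff, hadj]
  constructor <;> ext x
  · exact U.symm_apply_apply x
  · exact U.apply_symm_apply x

theorem isStarNormal_unitaryCLM (U : H ≃ₗᵢ[ℂ] H) : IsStarNormal (unitaryCLM U) := by
  have h := unitaryCLM_mem_unitary U
  exact ⟨by rw [commute_iff_eq, Unitary.star_mul_self_of_mem h, Unitary.mul_star_self_of_mem h]⟩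

theorem spectrum_unitaryCLM_subset (U : H ≃ₗᵢ[ℂ] H) :
    spectrum ℂ (unitaryCLM U) ⊆ Metric.sphere 0 1 :=
  spectrum.subset_circle_of_unitary (unitaryCLM_mem_unitary U)

/-- The inclusion of the spectrum of a unitary operator into the circle. -/
noncomputable def spectrumToCircle (U : H ≃ₗᵢ[ℂ] H) : C(spectrum ℂ (unitaryCLM U), Circle) where
  toFun z := ⟨z, spectrum_unitaryCLM_subset U z.2⟩
  continuous_toFun := by fun_prop

/-- The continuous functional calculus of a unitary operator for functions on the circle. -/
noncomputable def unitaryCalculus (U : H ≃ₗᵢ[ℂ] H) : C(Circle, ℂ) →⋆ₐ[ℂ] (H →L[ℂ] H) :=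
  (cfcHom (isStarNormal_unitaryCLM U)).comp
    (ContinuousMap.compStarAlgHom' ℂ ℂ (spectrumToCircle U))

theorem unitaryCalculus_restrict (U : H ≃ₗᵢ[ℂ] H) (P : ℂ → ℂ) (φ : C(Circle, ℂ))
    (h : ∀ z : Circle, φ z = P z) : unitaryCalculus U φ = cfc P (unitaryCLM U) := by
  -- `cfc` defaults to 0 for functions not continuous on the spectrum, so continuity has to be
  -- supplied; it comes from `φ`.
  have hc : ContinuousOn P (spectrum ℂ (unitaryCLM U)) := by
    rw [continuousOn_iff_continuous_domRestrict]
    refine (φ.comp (spectrumToCircle U)).continuous.congr fun z => ?_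
    exact h _
  rw [cfc_apply P (unitaryCLM U) (isStarNormal_unitaryCLM U) hc]
  refine congrArg (cfcHom (isStarNormal_unitaryCLM U)) ?_
  ext z
  exact h _

theorem unitaryCalculus_circleChar_one (U : H ≃ₗᵢ[ℂ] H) :
    unitaryCalculus U (circleChar 1) = unitaryCLM U := by
  rw [unitaryCalculus_restrict U id _ (fun z => by simp)]
  exact cfc_id ℂ _ (isStarNormal_unitaryCLM U)

theorem unitaryCalculus_circleChar (U : H ≃ₗᵢ[ℂ] H) (n : ℤ) (x : H) :
    unitaryCalculus U (circleChar n) x = (U ^ n) x := by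
  induction n generalizing x with
  | zero => simp [circleChar_zero]
  | succ n ih =>
    rw [circleChar_add, map_mul, unitaryCalculus_circleChar_one, zpow_add_one]
    exact ih (U x)
  | pred n ih =>
    have h : circleChar (-n) = circleChar (-n - 1) * circleChar 1 := by
      rw [← circleChar_add, sub_add_cancel]
    rw [h, map_mul, unitaryCalculus_circleChar_one] at ih
    have h1 := ih (U⁻¹ x)
    rw [zpow_sub_one]
    refine Eq.trans ?_ h1
    change _ = unitaryCalculus U (circleChar (-n - 1)) (U (U.symm x))
    rw [U.apply_symm_apply]

/-- The continuous function on the circle given by the pointwise complexification. -/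
noncomputable def complexify (f : C(Circle, ℝ)) : C(Circle, ℂ) :=
  ⟨fun z => (f z : ℂ), Complex.continuous_ofReal.comp f.continuous⟩

/-- With `g = √f`, the inner product is `‖g(U) x‖²`. This positivity is what the Riesz
representation theorem needs. -/
theorem inner_unitaryCalculus_complexify_nonneg (U : H ≃ₗᵢ[ℂ] H) (x : H) (f : C(Circle, ℝ))
    (hf : ∀ z, 0 ≤ f z) : 0 ≤ (inner ℂ x (unitaryCalculus U (complexify f) x)).re := by
  let g : C(Circle, ℂ) := complexify ⟨fun z => √(f z), by fun_prop⟩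
  have hg : complexify f = star g * g := by
    ext z
    change (f z : ℂ) = star ((√(f z) : ℝ) : ℂ) * ((√(f z) : ℝ) : ℂ)
    rw [Complex.star_def, Complex.conj_ofReal, ← Complex.ofReal_mul, Real.mul_self_sqrt (hf z)]
  rw [hg, map_mul, map_star, mul_apply_eq_comp, ContinuousLinearMap.star_eq_adjoint,
    ContinuousLinearMap.adjoint_inner_right, inner_self_eq_norm_sq_to_K]
  exact_mod_cast sq_nonneg ‖unitaryCalculus U g x‖

/-- The positive functional `f ↦ ⟨f(U) x, x⟩`. -/
noncomputable def spectralFunctional (U : H ≃ₗᵢ[ℂ] H) (x : H) :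
    CompactlySupportedContinuousMap Circle ℝ →ₚ[ℝ] ℝ :=
  PositiveLinearMap.mk₀
    { toFun := fun f => (inner ℂ x (unitaryCalculus U (complexify f) x)).re
      map_add' := fun f g => by
        have : complexify (f + g : CompactlySupportedContinuousMap Circle ℝ)
            = complexify f + complexify g := by ext z; simp [complexify]
        rw [this, map_add, add_apply, inner_add_right, Complex.add_re]
      map_smul' := fun c f => by
        have : complexify (c • f : CompactlySupportedContinuousMap Circle ℝ)
            = (c : ℂ) • complexify f := by ext z; simp [complexify]
        rw [this, map_smul, smul_apply, inner_smul_right,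
          Complex.re_ofReal_mul]
        rfl }
    fun f hf => inner_unitaryCalculus_complexify_nonneg U x f hf

/-- The spectral measure of a vector under a unitary operator. -/
noncomputable def spectralMeasure (U : H ≃ₗᵢ[ℂ] H) (x : H) : Measure Circle :=
  RealRMK.rieszMeasure (spectralFunctional U x)

instance (U : H ≃ₗᵢ[ℂ] H) (x : H) : IsFiniteMeasure (spectralMeasure U x) :=
  inferInstanceAs (IsFiniteMeasure (RealRMK.rieszMeasure _))

theorem integral_real_spectralMeasure (U : H ≃ₗᵢ[ℂ] H) (x : H) (f : C(Circle, ℝ)) :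
    ∫ z, f z ∂(spectralMeasure U x) = (inner ℂ x (unitaryCalculus U (complexify f) x)).re :=
  RealRMK.integral_rieszMeasure (spectralFunctional U x)
    ⟨f, HasCompactSupport.of_compactSpace _⟩

theorem inner_unitaryCalculus_complexify_im (U : H ≃ₗᵢ[ℂ] H) (x : H) (f : C(Circle, ℝ)) :
    (inner ℂ x (unitaryCalculus U (complexify f) x)).im = 0 := by
  have hs : star (complexify f) = complexify f := by
    ext z
    exact Complex.conj_ofReal _
  have h : inner ℂ (unitaryCalculus U (complexify f) x) x
      = inner ℂ x (unitaryCalculus U (complexify f) x) := by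
    conv_rhs => rw [← hs, map_star, ContinuousLinearMap.star_eq_adjoint,
      ContinuousLinearMap.adjoint_inner_right]
  rw [← inner_conj_symm] at h
  exact Complex.conj_eq_iff_im.1 h

theorem integral_spectralMeasure (U : H ≃ₗᵢ[ℂ] H) (x : H) (φ : C(Circle, ℂ)) :
    ∫ z, φ z ∂(spectralMeasure U x) = inner ℂ x (unitaryCalculus U φ x) := by
  let a : C(Circle, ℝ) := ⟨fun z => (φ z).re, by fun_prop⟩
  let b : C(Circle, ℝ) := ⟨fun z => (φ z).im, by fun_prop⟩
  have key : ∀ f : C(Circle, ℝ), ∫ z, complexify f z ∂(spectralMeasure U x)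
      = inner ℂ x (unitaryCalculus U (complexify f) x) := by
    intro f
    refine integral_complex_ofReal.trans ?_
    rw [integral_real_spectralMeasure]
    refine Complex.ext rfl ?_
    rw [inner_unitaryCalculus_complexify_im, Complex.ofReal_im]
  have hφ : φ = complexify a + Complex.I • complexify b := by
    ext z
    simp only [complexify, a, b, ContinuousMap.add_apply, ContinuousMap.smul_apply,
      ContinuousMap.coe_mk, smul_eq_mul]
    rw [mul_comm, Complex.re_add_im]
  rw [hφ, map_add, map_smul, add_apply, smul_apply,
    inner_add_right, inner_smul_right, ← key, ← key, ← integral_const_mul]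
  exact integral_add (integrable_continuousMap _ (complexify a))
    (integrable_continuousMap _ (Complex.I • complexify b))

theorem isSpectralMeasure_spectralMeasure (U : H ≃ₗᵢ[ℂ] H) (x : H) :
    IsSpectralMeasure U x (spectralMeasure U x) :=
  ⟨inferInstance, fun n =>
    (integral_spectralMeasure U x (circleChar n)).trans (by rw [unitaryCalculus_circleChar])⟩

theorem IsSpectralMeasure.eq_spectralMeasure {U : H ≃ₗᵢ[ℂ] H} {x : H} {ρ : Measure Circle}
    (h : IsSpectralMeasure U x ρ) : ρ = spectralMeasure U x := by
  have := h.finite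
  refine measure_ext_of_fourier fun n => ?_
  exact (h.fourier n).trans ((isSpectralMeasure_spectralMeasure U x).fourier n).symm

theorem spectralMeasure_univ (U : H ≃ₗᵢ[ℂ] H) (x : H) :
    spectralMeasure U x Set.univ = ENNReal.ofReal (‖x‖ ^ 2) := by
  have h := (isSpectralMeasure_spectralMeasure U x).fourier 0
  simp only [zpow_zero, Circle.coe_one, integral_const] at h
  change _ = inner ℂ x x at h
  rw [inner_self_eq_norm_sq_to_K] at h
  rw [← ofReal_measureReal]
  congr 1
  have h2 : (((spectralMeasure U x).real Set.univ : ℝ) : ℂ) = ((‖x‖ ^ 2 : ℝ) : ℂ) := by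
    simpa using h
  exact_mod_cast h2

/-- The parallelogram identity, valid for every Fourier coefficient because these are quadratic in
the vector. -/
theorem spectralMeasure_add_add_sub (U : H ≃ₗᵢ[ℂ] H) (x y : H) :
    spectralMeasure U (x + y) + spectralMeasure U (x - y)
      = (2 : ENNReal) • (spectralMeasure U x + spectralMeasure U y) := by
  have : IsFiniteMeasure ((2 : ENNReal) • (spectralMeasure U x + spectralMeasure U y)) :=
    Measure.smul_finite _ (by simp)
  refine measure_ext_of_fourier fun n => ?_
  rw [integral_add_measure (integrable_continuousMap _ _) (integrable_continuousMap _ _),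
    integral_smul_measure, integral_add_measure (integrable_continuousMap _ _)
      (integrable_continuousMap _ _)]
  simp only [integral_spectralMeasure, map_add, map_sub, inner_add_left, inner_add_right,
    inner_sub_left, inner_sub_right]
  simp only [ENNReal.toReal_ofNat, Complex.real_smul, Complex.ofReal_ofNat]
  ring

/-- Apply the parallelogram identity to `y` and `x - y`, drop the second measure on the left, and
bound the measure of `x - y` by its total mass. The bound is uniform in `A`, which lets null sets
survive limits of vectors. -/
theorem spectralMeasure_le (U : H ≃ₗᵢ[ℂ] H) (x y : H) (A : Set Circle) :
    spectralMeasure U x A ≤ 2 * (spectralMeasure U y A + ENNReal.ofReal (‖x - y‖ ^ 2)) := by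
  have h := congrArg (fun m : Measure Circle => m A) (spectralMeasure_add_add_sub U y (x - y))
  simp only [add_sub_cancel, Measure.add_apply, Measure.smul_apply, smul_eq_mul] at h
  calc spectralMeasure U x A ≤ 2 * (spectralMeasure U y A + spectralMeasure U (x - y) A) :=
        h ▸ le_self_add
    _ ≤ _ := by
      gcongr
      rw [← spectralMeasure_univ U]
      exact measure_mono (Set.subset_univ A)

/-- A set that is null for the spectral measures of all vectors of `D` is null for the
spectral measures of all vectors in the closure of `D`. -/
theorem spectralMeasure_eq_zero_of_mem_closure (U : H ≃ₗᵢ[ℂ] H) {D : Set H} {A : Set Circle}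
    (hD : ∀ y ∈ D, spectralMeasure U y A = 0) {x : H} (hx : x ∈ closure D) :
    spectralMeasure U x A = 0 := by
  obtain ⟨u, hu, hlim⟩ := mem_closure_iff_seq_limit.1 hx
  have h1 : Tendsto (fun k => ‖x - u k‖ ^ 2) atTop (𝓝 0) := by
    simpa using ((tendsto_const_nhds (x := x)).sub hlim).norm.pow 2
  have h2 : Tendsto (fun k => 2 * ENNReal.ofReal (‖x - u k‖ ^ 2)) atTop (𝓝 0) := by
    simpa using ENNReal.Tendsto.const_mul (a := 2) (ENNReal.tendsto_ofReal h1) (by simp)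
  refine le_antisymm (ge_of_tendsto' h2 fun k => ?_) bot_le
  simpa [hD _ (hu k)] using spectralMeasure_le U x (u k) A

/-- Every nonempty set of vectors of a separable space has a maximal spectral type, represented by
a weighted sum of the spectral measures of countably many of its vectors. -/
theorem exists_isMaximalSpectralType [TopologicalSpace.SeparableSpace H] (U : H ≃ₗᵢ[ℂ] H)
    (K : Set H) (hK : K.Nonempty) :
    ∃ (u : ℕ → H) (c : ℕ → ENNReal), (∀ k, u k ∈ K) ∧
      IsMaximalSpectralType U K (Measure.sum fun k => c k • spectralMeasure U (u k)) := by
  have := hK.to_subtype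
  have : SecondCountableTopology H := UniformSpace.secondCountable_of_separable H
  let u : ℕ → H := fun k => TopologicalSpace.denseSeq K k
  have hu : ∀ k, u k ∈ K := fun k => (TopologicalSpace.denseSeq K k).2
  have hd : K ⊆ closure (Set.range u) := by
    intro x hx
    have := (TopologicalSpace.denseRange_denseSeq K).closure_range
    have h2 : (⟨x, hx⟩ : K) ∈ closure (Set.range (TopologicalSpace.denseSeq K)) := this ▸ trivial
    have h3 := closure_subtype.1 h2
    rwa [← Set.range_comp] at h3
  -- The second factor makes each weighted mass at most `2⁻ᵏ`; all weights are nonzero, so null sets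
  -- of the sum are null for every summand.
  let c : ℕ → ENNReal := fun k => 2⁻¹ ^ k * (1 + ENNReal.ofReal (‖u k‖ ^ 2))⁻¹
  have hc : ∀ k, c k ≠ 0 := fun k => by
    simp [c, ENNReal.inv_eq_zero]
  refine ⟨u, c, hu, ⟨⟨?_⟩, ?_, ?_⟩⟩
  · rw [Measure.sum_apply _ MeasurableSet.univ]
    calc ∑' k, (c k • spectralMeasure U (u k)) Set.univ ≤ ∑' k : ℕ, (2⁻¹ : ENNReal) ^ k := by
          refine ENNReal.tsum_le_tsum fun k => ?_
          rw [Measure.smul_apply, smul_eq_mul, spectralMeasure_univ, mul_assoc]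
          refine mul_le_of_le_one_right' ?_
          rw [mul_comm, ← div_eq_mul_inv]
          exact ENNReal.div_le_of_le_mul (by rw [one_mul]; exact le_add_self)
      _ < ⊤ := by rw [ENNReal.tsum_geometric]; simp
  · intro f hf ρ hρ
    rw [hρ.eq_spectralMeasure]
    refine Measure.AbsolutelyContinuous.mk fun A hA h0 => ?_
    rw [Measure.sum_apply _ hA, ENNReal.tsum_eq_zero] at h0
    refine spectralMeasure_eq_zero_of_mem_closure U (D := Set.range u) ?_ (hd hf)
    rintro - ⟨k, rfl⟩
    simpa [hc k] using h0 k
  · intro ν hν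
    refine Measure.absolutelyContinuous_sum_left fun k => ?_
    exact (hν (u k) (hu k) _ (isSpectralMeasure_spectralMeasure U (u k))).smul_left (c k)

end SpectralMeasure

/-! ### Koopman operators and mixing -/

section KoopmanMixing

variable {X : Type*} [MeasurableSpace X] {μ : Measure X}

theorem koopman_apply (T : X ≃ᵐ X) (hT : MeasurePreserving T μ μ) (f : Lp ℂ 2 μ) :
    koopman T hT f = Lp.compMeasurePreserving (T.symm : X → X) (hT.symm T) f := rfl

theorem koopman_inv_apply (T : X ≃ᵐ X) (hT : MeasurePreserving T μ μ) (f : Lp ℂ 2 μ) :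
    (koopman T hT)⁻¹ f = Lp.compMeasurePreserving T hT f := by
  change (koopman T hT).symm f = _
  rw [LinearIsometryEquiv.symm_apply_eq, koopman_apply,
    ← Lp.compMeasurePreserving_comp_apply f hT (hT.symm T)]
  have hid : ((T : X → X) ∘ (T.symm : X → X)) = id := by
    funext x; simp
  simp only [hid]
  exact (Lp.compMeasurePreserving_id_apply f).symm

/-- Inverse powers match the preimages `T⁻ⁿA` in the definition of mixing, since `U_T` composes with
`T⁻¹`. -/
theorem koopman_inv_pow_apply (T : X ≃ᵐ X) (hT : MeasurePreserving T μ μ) (n : ℕ)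
    (f : Lp ℂ 2 μ) :
    ((koopman T hT)⁻¹ ^ n) f = Lp.compMeasurePreserving T^[n] (hT.iterate n) f := by
  rw [← Lp.compMeasurePreserving_iterate]
  induction n generalizing f with
  | zero => rfl
  | succ n ih =>
    rw [pow_succ, Function.iterate_succ_apply, ← koopman_inv_apply]
    exact ih _

theorem koopman_mem_L2zero_iff (T : X ≃ᵐ X) (hT : MeasurePreserving T μ μ) (f : Lp ℂ 2 μ) :
    koopman T hT f ∈ L2zero μ ↔ f ∈ L2zero μ := by
  have h : ∫ x, koopman T hT f x ∂μ = ∫ x, f x ∂μ := by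
    rw [koopman_apply, integral_congr_ae (Lp.coeFn_compMeasurePreserving f (hT.symm T))]
    exact (hT.symm T).integral_comp' f
  change ∫ x, koopman T hT f x ∂μ = 0 ↔ ∫ x, f x ∂μ = 0
  rw [h]

theorem koopman_zpow_mem_L2zero (T : X ≃ᵐ X) (hT : MeasurePreserving T μ μ) (n : ℤ)
    {f : Lp ℂ 2 μ} (hf : f ∈ L2zero μ) : (koopman T hT ^ n) f ∈ L2zero μ := by
  induction n with
  | zero => exact hf
  | succ n ih =>
    rw [zpow_add_one, (Commute.zpow_self (koopman T hT) n).eq]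
    exact (koopman_mem_L2zero_iff T hT _).2 ih
  | pred n ih =>
    rw [← koopman_mem_L2zero_iff T hT]
    change (koopman T hT * koopman T hT ^ (-(n : ℤ) - 1)) f ∈ _
    rwa [← zpow_one_add, add_sub_cancel]

variable [IsProbabilityMeasure μ]

/-- The constant function one. -/
noncomputable def L2one (μ : Measure X) [IsProbabilityMeasure μ] : Lp ℂ 2 μ :=
  indicatorConstLp 2 MeasurableSet.univ (measure_ne_top μ _) 1

theorem inner_L2one_of_mem_L2zero {f : Lp ℂ 2 μ} (hf : f ∈ L2zero μ) :
    inner ℂ (L2one μ) f = 0 := by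
  rw [L2one, L2.inner_indicatorConstLp_one, setIntegral_univ]
  exact hf

theorem norm_L2one_le : ‖L2one μ‖ ≤ 1 := by
  simpa [L2one] using norm_indicatorConstLp_le (p := 2) (μ := μ) (s := Set.univ)
    (hs := MeasurableSet.univ) (hμs := measure_ne_top μ _) (c := (1 : ℂ))

/-- Mixing in terms of the correlations of square-integrable functions. -/
theorem Mixing.tendsto_inner {T : X ≃ᵐ X} (hT : MeasurePreserving T μ μ) (h : Mixing T μ)
    (f g : Lp ℂ 2 μ) :
    Tendsto (fun n : ℕ => inner ℂ (((koopman T hT)⁻¹ ^ n) f) g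
      - inner ℂ f (L2one μ) * inner ℂ (L2one μ) g) atTop (𝓝 0) := by
  have hbound : ∀ (n : ℕ) (f g : Lp ℂ 2 μ), ‖inner ℂ (((koopman T hT)⁻¹ ^ n) f) g
      - inner ℂ f (L2one μ) * inner ℂ (L2one μ) g‖ ≤ 2 * ‖f‖ * ‖g‖ := by
    intro n f g
    have h1 : ‖inner ℂ (((koopman T hT)⁻¹ ^ n) f) g‖ ≤ ‖f‖ * ‖g‖ := by
      simpa only [LinearIsometryEquiv.norm_map] using
        norm_inner_le_norm (𝕜 := ℂ) (((koopman T hT)⁻¹ ^ n) f) g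
    have h2 : ‖inner ℂ f (L2one μ)‖ ≤ ‖f‖ := (norm_inner_le_norm _ _).trans
      (mul_le_of_le_one_right (norm_nonneg _) norm_L2one_le)
    have h3 : ‖inner ℂ (L2one μ) g‖ ≤ ‖g‖ := (norm_inner_le_norm _ _).trans
      (mul_le_of_le_one_left (norm_nonneg _) norm_L2one_le)
    calc _ ≤ ‖inner ℂ (((koopman T hT)⁻¹ ^ n) f) g‖
          + ‖inner ℂ f (L2one μ) * inner ℂ (L2one μ) g‖ := norm_sub_le _ _
      _ ≤ ‖f‖ * ‖g‖ + ‖f‖ * ‖g‖ := by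
        rw [norm_mul]
        gcongr
      _ = 2 * ‖f‖ * ‖g‖ := by ring
  -- Mixing is the case of two indicators; additivity and the bound `hbound` extend it to `L²` in
  -- each variable. Subtracting the product of means allows indicators, which need not have zero
  -- integral.
  induction f using Lp.induction (p := 2) ENNReal.ofNat_ne_top with
  | indicatorConst a hA hμA =>
    induction g using Lp.induction (p := 2) ENNReal.ofNat_ne_top with
    | indicatorConst b hB hμB =>
      rename_i A B
      have h1 := h A B hA hB
      rw [← tendsto_sub_nhds_zero_iff] at h1
      have h2 := ((Complex.continuous_ofReal.tendsto 0).comp h1).mul_const (inner ℂ a b)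
      rw [Complex.ofReal_zero, zero_mul] at h2
      refine h2.congr fun n => ?_
      simp only [Lp.simpleFunc.coe_indicatorConst, koopman_inv_pow_apply,
        Lp.indicatorConstLp_compMeasurePreserving, L2one,
        L2.inner_indicatorConstLp_indicatorConstLp, Set.inter_univ, Set.univ_inter,
        Function.comp_apply, Complex.real_smul]
      simp
      ring
    | add hf hg _ h1 h2 =>
      refine (add_zero (0 : ℂ) ▸ h1.add h2).congr fun n => ?_
      simp only [inner_add_right]
      ring
    | isClosed =>
      refine isClosed_setOf_tendsto_zero atTop (fun n => AddMonoidHom.mk' (fun g =>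
        inner ℂ (((koopman T hT)⁻¹ ^ n) _) g - inner ℂ _ (L2one μ) * inner ℂ (L2one μ) g) ?_) _
        fun n => hbound n _
      intro g k
      simp only [inner_add_right]
      ring
  | add hf hg _ h1 h2 =>
    refine (add_zero (0 : ℂ) ▸ h1.add h2).congr fun n => ?_
    simp only [map_add, inner_add_left]
    ring
  | isClosed =>
    refine isClosed_setOf_tendsto_zero atTop (fun n => AddMonoidHom.mk' (fun f =>
      inner ℂ (((koopman T hT)⁻¹ ^ n) f) g - inner ℂ f (L2one μ) * inner ℂ (L2one μ) g) ?_)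
      (2 * ‖g‖) fun n f => (hbound n f g).trans (by ring_nf; rfl)
    intro f k
    simp only [map_add, inner_add_left]
    ring

/-- The spectral measures of a mixing transformation are Rajchman. -/
theorem Mixing.rajchman_spectralMeasure {T : X ≃ᵐ X} (hT : MeasurePreserving T μ μ)
    (h : Mixing T μ) {f : Lp ℂ 2 μ} (hf : f ∈ L2zero μ) :
    Rajchman (spectralMeasure (koopman T hT) f) := by
  have h1 : Tendsto (fun n : ℕ => inner ℂ (((koopman T hT)⁻¹ ^ n) f) f) atTop (𝓝 0) := by
    simpa [inner_L2one_of_mem_L2zero hf] using h.tendsto_inner hT f f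
  have hneg : ∀ n : ℤ, inner ℂ f ((koopman T hT ^ (-n)) f)
      = inner ℂ ((koopman T hT ^ n) f) f := by
    intro n
    rw [← (koopman T hT ^ n).inner_map_map f]
    change inner ℂ _ ((koopman T hT ^ n * koopman T hT ^ (-n)) f) = _
    rw [← zpow_add, add_neg_cancel, zpow_zero]
    rfl
  have h2 : Tendsto (fun n : ℤ => inner ℂ f ((koopman T hT ^ n) f)) atTop (𝓝 0) := by
    rw [← Nat.map_cast_int_atTop, tendsto_map'_iff]
    refine h1.congr fun n => ?_
    have := hneg (-n)
    rw [neg_neg, zpow_neg, zpow_natCast, ← inv_pow] at this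
    exact this.symm
  -- Mixing concerns one time direction only; Fourier coefficients at `-n` and `n` are complex
  -- conjugates.
  have h3 : Tendsto (fun n : ℤ => inner ℂ f ((koopman T hT ^ n) f)) atBot (𝓝 0) := by
    have h4 := (Complex.continuous_conj.tendsto 0).comp (h2.comp tendsto_neg_atBot_atTop)
    rw [map_zero] at h4
    refine h4.congr fun n => ?_
    simp only [Function.comp_apply]
    rw [hneg, inner_conj_symm]
  have h4 := h3.sup h2
  rw [← Int.cofinite_eq] at h4
  exact h4.congr fun n => ((isSpectralMeasure_spectralMeasure (koopman T hT) f).fourier n).symm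

end KoopmanMixing

/-! ### Transfer of the weak limit and conclusion -/

theorem L2zero_nonempty {X : Type*} [MeasurableSpace X] (μ : Measure X) : (L2zero μ).Nonempty :=
  ⟨0, (integral_congr_ae (Lp.coeFn_zero ℂ 2 μ)).trans (by simp)⟩

/-- A sequence with infinitely many values leaves all finite sets along some filter. -/
theorem neBot_atTop_inf_comap_cofinite {n : ℕ → ℤ} (hn : (Set.range n).Infinite) :
    (atTop ⊓ comap n cofinite).NeBot := by
  refine inf_neBot_iff.2 fun {s} hs {t} ht => ?_
  obtain ⟨N, hN⟩ := mem_atTop_sets.1 hs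
  obtain ⟨r, hr, hrt⟩ := mem_comap.1 ht
  by_contra hemp
  -- Otherwise every value of `n` is taken before `N` or lies in the finite complement of `r`.
  refine hn (((Set.finite_Iio N).image n).union (mem_cofinite.1 hr) |>.subset ?_)
  rintro - ⟨k, rfl⟩
  rcases lt_or_ge k N with hk | hk
  · exact Or.inl ⟨k, hk, rfl⟩
  · exact Or.inr fun hkr => hemp ⟨k, hN k hk, hrt hkr⟩

/-- Weak convergence `U_T ^ nᵢ → P(U_T)` on the functions of zero integral, in terms of the
spectral measures. -/
theorem tendsto_integral_circleChar_of_weak_limit {X : Type*} [MeasurableSpace X] {μ : Measure X}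
    (T : X ≃ᵐ X) (hT : MeasurePreserving T μ μ) {ι : Type*} {l : Filter ι} (n : ι → ℤ)
    (P : ℂ → ℂ) (φ : C(Circle, ℂ)) (hφ : ∀ z : Circle, φ z = P z)
    (hlim : ∀ f ∈ L2zero μ, ∀ g ∈ L2zero μ,
      Tendsto (fun k => inner ℂ g ((koopman T hT ^ n k) f)) l
        (𝓝 (inner ℂ g (koopmanFun P T hT f))))
    {f : Lp ℂ 2 μ} (hf : f ∈ L2zero μ) (m : ℤ) :
    Tendsto (fun k => ∫ z, circleChar (n k + m) z ∂(spectralMeasure (koopman T hT) f)) l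
      (𝓝 (∫ z, circleChar m z * φ z ∂(spectralMeasure (koopman T hT) f))) := by
  set U := koopman T hT with hU
  have hadj : ∀ g : Lp ℂ 2 μ, inner ℂ f ((U ^ m) g) = inner ℂ ((U ^ (-m)) f) g := by
    intro g
    rw [← (U ^ (-m)).inner_map_map f]
    change inner ℂ _ ((U ^ (-m) * U ^ m) g) = _
    rw [← zpow_add, neg_add_cancel, zpow_zero]
    rfl
  -- The character `z ^ m` is moved onto the other vector as `U ^ (-m)`, which preserves zero
  -- integral, so the hypothesis applies.
  have h := hlim f hf _ (koopman_zpow_mem_L2zero T hT (-m) hf)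
  have h1 : ∫ z, circleChar m z * φ z ∂(spectralMeasure U f)
      = inner ℂ ((U ^ (-m)) f) (koopmanFun P T hT f) := by
    refine (integral_spectralMeasure U f (circleChar m * φ)).trans ?_
    rw [map_mul, mul_apply_eq_comp, unitaryCalculus_circleChar, hadj,
      unitaryCalculus_restrict U P φ hφ]
    rfl
  rw [h1]
  refine h.congr fun k => ?_
  rw [integral_spectralMeasure, unitaryCalculus_circleChar, add_comm, zpow_add, ← hadj]
  rfl

end SpectralDisjoint

theorem mainTheorem4 {X Y : Type*} [MeasurableSpace X] [MeasurableSpace Y]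
    (μ : Measure X) [IsProbabilityMeasure μ] [MeasureTheory.IsSeparable μ]
    (ν : Measure Y) [IsProbabilityMeasure ν] [MeasureTheory.IsSeparable ν]
    (T : X ≃ᵐ X) (hT : MeasurePreserving T μ μ) (hTwm : SpectralDisjoint.WeaklyMixing T μ)
    (n : ℕ → ℤ) (hn : (Set.range n).Infinite)
    (P : ℂ → ℂ) (hP : AnalyticOnNhd ℂ P (Metric.sphere 0 1))
    (hP0 : ∃ z ∈ Metric.sphere (0 : ℂ) 1, P z ≠ 0)
    (hlim : ∀ f ∈ SpectralDisjoint.L2zero μ, ∀ g ∈ SpectralDisjoint.L2zero μ,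
      Tendsto (fun k : ℕ => inner ℂ g ((SpectralDisjoint.koopman T hT ^ n k) f)) atTop
        (𝓝 (inner ℂ g (SpectralDisjoint.koopmanFun P T hT f))))
    (S : Y ≃ᵐ Y) (hS : MeasurePreserving S ν ν) (hSm : SpectralDisjoint.Mixing S ν) :
    SpectralDisjoint.SpectrallyDisjoint T hT S hS := by
  open SpectralDisjoint in
  have : Fact ((2 : ENNReal) ≠ ⊤) := ⟨by simp⟩
  obtain ⟨u, c, hu, hσ⟩ := exists_isMaximalSpectralType (koopman T hT) (L2zero μ) (L2zero_nonempty μ)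
  obtain ⟨v, d, hv, hτ⟩ := exists_isMaximalSpectralType (koopman S hS) (L2zero ν) (L2zero_nonempty ν)
  refine ⟨_, _, hσ, hτ, ?_⟩
  let φ : C(Circle, ℂ) := ⟨fun z => P z, hP.continuousOn.comp_continuous
    continuous_subtype_val fun z => z.2⟩
  -- The sequence may return to one value infinitely often; this filter keeps only the passage to
  -- infinity through ever new exponents.
  have hbot := neBot_atTop_inf_comap_cofinite hn
  refine Measure.MutuallySingular.sum_left.2 fun i => Measure.MutuallySingular.sum_right.2
    fun j => (Measure.MutuallySingular.smul (c i) ?_).symm.smul (d j) |>.symm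
  refine mutuallySingular_of_rajchman (l := atTop ⊓ comap n cofinite)
    (tendsto_comap.mono_left inf_le_right) φ (countable_zeros_of_analyticOnNhd_sphere hP hP0)
    (fun m => ?_) (hSm.rajchman_spectralMeasure hS (hv j))
  exact (tendsto_integral_circleChar_of_weak_limit T hT n P φ (fun _ => rfl) hlim
    (hu i) m).mono_left inf_le_left
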